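/- A \emph{3-D truss} $\mathcal T$ consists of a set $V$ of $n$ vertices embedded at distinct points $p_i\in\mathbb R^3$ ($i \in V$), a set $T$ of tetrahedra, each given by four vertices whose points are not coplanar (and identified with the convex hull of these points), such that every vertex lies in some tetrahedron, the set $E$ of all pairs of distinct vertices that appear in some tetrahedron together, and stiffness coefficients $\gamma(e)>0$ for $e\in E$. Its \emph{stiffness matrix} is the $3n\times 3n$ matrix $$M=\sum_{e=\{i,j\}\in E}\frac{\gamma(e)}{\|p_i-p_j\|_2}\, b^{(e)}b^{(e)\top},$$ where $b^{(e)}\in\mathbb R^{3n}$ has the block $\frac{p_i-p_j}{\|p_i-p_j\|_2}\in\mathbb R^3$ at $i$, the negative of this block at $j$, and zeros elsewhere. For constants $\alpha$, $0<\ell_1\le\ell_2$ and $0<\gamma_1\le\gamma_2$, the truss is \emph{edge-simple} (with these constants) if the intersection of any two tetrahedra is empty or a face of both, every tetrahedron has aspect ratio at most $\alpha$ (the radius of the smallest ball containing it divided by the radius of the largest ball inscribed in it), every edge has length in $[\ell_1,\ell_2]$, and $\gamma(e)\in[\gamma_1,\gamma_2]$ for every $e\in E$. The \emph{rigidity graph}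 has the tetrahedra as its vertices and joins two distinct tetrahedra that share a triangle face. The truss is \emph{stiffly-connected} if its rigidity graph is connected (and nonempty) and, for every vertex $v\in V$, the subgraph of the rigidity graph induced on the tetrahedra containing $v$ is connected. \textbf{Lemma.} For all constants $\alpha$, $0<\ell_1\le\ell_2$, $0<\gamma_1\le\gamma_2$ there is a constant $c>0$, depending only on them, such that the following holds for every edge-simple (with these constants), stiffly-connected 3-D truss $\mathcal T$. Let $n$ be its number of vertices and let $\Delta$ be its diameter, i.e. the largest number of edges on a shortest path between two vertices in the graph $(V,E)$. Then $\operatorname{rank}(M)=3n-6$, and the smallest nonzero eigenvalue of $M$ satisfies $$\lambda_{\min}(M)\ \ge\ \frac{c}{n\,\Delta^{4}}.$$ -/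

import Mathlib

noncomputable section

/-- Points of three-dimensional Euclidean space. -/
abbrev Point3 := EuclideanSpace ℝ (Fin 3)

/-- The radius of the smallest ball containing `S`. -/
def outerRadius (S : Set Point3) : ℝ :=
  sInf {r : ℝ | 0 ≤ r ∧ ∃ c : Point3, S ⊆ Metric.closedBall c r}

/-- The radius of the largest ball inscribed in `S`. -/
def innerRadius (S : Set Point3) : ℝ :=
  sSup {r : ℝ | 0 ≤ r ∧ ∃ c : Point3, Metric.closedBall c r ⊆ S}

/-- The aspect ratio of `S`: the radius of the smallest ball containing `S` over the radius of the
largest ball inscribed in `S`. It is only used for tetrahedra, where both radii are positive. -/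
def aspectRatio (S : Set Point3) : ℝ :=
  outerRadius S / innerRadius S

/-- A tetrahedral mesh on the vertex set `V`: the vertices sit at distinct points of `ℝ³`, and every
tetrahedron is given by a set of four vertices whose positions are not coplanar. -/
structure TetMesh (V : Type*) where
  /-- the position of each vertex -/
  pos : V → Point3
  pos_injective : Function.Injective pos
  /-- the tetrahedra, as sets of four vertices -/
  tets : Finset (Finset V)
  card_tet : ∀ t ∈ tets, t.card = 4
  affineIndependent_tet : ∀ t ∈ tets, AffineIndependent ℝ (fun i : {x // x ∈ t} => pos i.1)

namespace TetMesh

variable {V : Type*} (M : TetMesh V)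

/-- The convex hull of the positions of a set of vertices. -/
def hull (s : Finset V) : Set Point3 :=
  convexHull ℝ (M.pos '' (s : Set V))

/-- The intersection of every two tetrahedra is empty or a common face of both (the convex hull of a
nonempty set of vertices belonging to both). -/
def IsSimplicialComplex : Prop :=
  ∀ t ∈ M.tets, ∀ t' ∈ M.tets,
    M.hull t ∩ M.hull t' = ∅ ∨
      ∃ s : Finset V, s.Nonempty ∧ s ⊆ t ∧ s ⊆ t' ∧ M.hull t ∩ M.hull t' = M.hull s

/-- The mesh is simple, with aspect ratios of its tetrahedra bounded by `α`. -/
def IsSimple (α : ℝ) : Prop :=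
  M.IsSimplicialComplex ∧ ∀ t ∈ M.tets, aspectRatio (M.hull t) ≤ α

/-- The graph of edges of the mesh: two distinct vertices are adjacent when they appear in some
tetrahedron together. -/
def edgeGraph : SimpleGraph V where
  Adj i j := i ≠ j ∧ ∃ t ∈ M.tets, i ∈ t ∧ j ∈ t
  symm := ⟨fun _ _ h => ⟨h.1.symm, h.2.imp fun _ ht => ⟨ht.1, ht.2.2, ht.2.1⟩⟩⟩
  loopless := ⟨fun _ h => h.1 rfl⟩

/-- The rigidity graph: its vertices are the tetrahedra, and two of them are adjacent when they
share a triangle face, i.e. are distinct and have three vertices in common. -/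
def rigidityGraph : SimpleGraph {t // t ∈ M.tets} where
  Adj t t' := t ≠ t' ∧ ∃ f : Finset V, f.card = 3 ∧ f ⊆ t.1 ∧ f ⊆ t'.1
  symm := ⟨fun _ _ h => ⟨h.1.symm, h.2.imp fun _ hf => ⟨hf.1, hf.2.2, hf.2.1⟩⟩⟩
  loopless := ⟨fun _ h => h.1 rfl⟩

/-- The mesh is stiffly-connected. `Connected` includes that the graph has a vertex, so the mesh has
a tetrahedron and every element of `V` is a vertex of some tetrahedron. -/
def StifflyConnected : Prop :=
  M.rigidityGraph.Connected ∧
    ∀ v : V, (M.rigidityGraph.induce {t : {t // t ∈ M.tets} | v ∈ t.1}).Connected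

/-- The length of an edge. -/
def edgeLength (e : Sym2 V) : ℝ :=
  Sym2.lift ⟨fun i j => dist (M.pos i) (M.pos j), fun _ _ => dist_comm _ _⟩ e

end TetMesh

/-- A 3-dimensional truss: a tetrahedral mesh with a positive stiffness coefficient on each edge.
Values of `stiffness` off the edge set are never used. -/
structure Truss (V : Type*) extends TetMesh V where
  /-- the stiffness coefficient of each edge -/
  stiffness : Sym2 V → ℝ
  stiffness_pos : ∀ e ∈ toTetMesh.edgeGraph.edgeSet, 0 < stiffness e

namespace Truss

variable {V : Type*} (T : Truss V)

/-- The truss is edge-simple: its mesh is simple with aspect ratios at most `α`, all edge lengths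
lie in `[ℓ₁, ℓ₂]` and all stiffness coefficients lie in `[γ₁, γ₂]`. -/
def IsEdgeSimple (α ℓ₁ ℓ₂ γ₁ γ₂ : ℝ) : Prop :=
  T.toTetMesh.IsSimple α ∧
    ∀ e ∈ T.edgeGraph.edgeSet,
      T.edgeLength e ∈ Set.Icc ℓ₁ ℓ₂ ∧ T.stiffness e ∈ Set.Icc γ₁ γ₂

variable [DecidableEq V]

/-- The edge vector `b⁽ᵉ⁾ ∈ ℝ³ⁿ` of `e = {i, j}`: its block at `i` is
`(pᵢ - pⱼ) / ‖pᵢ - pⱼ‖`, its block at `j` is the negative of that, all other blocks vanish.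
The formula is symmetric in `i` and `j`. -/
def edgeVector (e : Sym2 V) : V × Fin 3 → ℝ :=
  Sym2.lift ⟨fun i j (k : V × Fin 3) =>
      ((if k.1 = i then 1 else 0) - (if k.1 = j then 1 else 0)) *
        ((T.pos i k.2 - T.pos j k.2) / ‖T.pos i - T.pos j‖),
    fun i j => by
      funext k
      dsimp only
      rw [norm_sub_rev (T.pos i) (T.pos j)]
      ring⟩ e

open Classical in
/-- The stiffness matrix `∑ₑ γ(e) / ‖pᵢ - pⱼ‖ • b⁽ᵉ⁾ b⁽ᵉ⁾ᵀ`, the sum being over the edges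
`e = {i, j}`. -/
def stiffnessMatrix [Fintype V] : Matrix (V × Fin 3) (V × Fin 3) ℝ :=
  ∑ e ∈ T.edgeGraph.edgeFinset,
    (T.stiffness e / T.edgeLength e) • Matrix.vecMulVec (T.edgeVector e) (T.edgeVector e)

end Truss

end

/-!
Let `x` be a displacement of the vertices with elastic energy `ε² = xᵀ M x`, so that every edge
changes its length by `O(ε)` to first order. On each tetrahedron `t` the displacement is affine, with
linear part `A t`. A tetrahedron of bounded aspect ratio contains a ball of radius bounded below, so
every vector shorter than it is a difference `∑ cᵢ pᵢ` (`∑ cᵢ = 0`) of two of its points. Writing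
the quadratic form at such a vector as `-½ ∑ᵢⱼ cᵢ cⱼ ⟪pᵢ - pⱼ, A t (pᵢ - pⱼ)⟫` bounds the symmetric
part of `A t` by `O(ε)` (`abs_inner_apply_le_of_closedBall_subset`).

If `t` and `t'` share a triangle, then `A t - A t'` vanishes on the plane of that triangle. Hence it
has rank at most one, and a map of rank at most one is controlled by its symmetric part
(`norm_apply_le_of_finrank_ker`), so `A t - A t'` is `O(ε)`. The inscribed balls of the tetrahedra
at a vertex are disjoint, which bounds the number of these tetrahedra (`card_mul_pow_le`); as they
are connected in the rigidity graph, all their linear parts agree up to `O(ε)`. Along a walk of `k`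
edges the linear part changes by `O(k ε)`, and the displacement departs from the initial affine
motion by `O(k² ε)` (`norm_displacement_sub_le_of_walk`). Dropping the small symmetric part of the
initial linear part leaves a rigid motion `r` with `‖x v - r v‖ = O(Δ² ε)` at each of the `n`
vertices, that is, `‖x - r‖² ≤ K n Δ⁴ xᵀ M x` (`exists_dotProduct_sub_rigidMotion_le`).

For `x` in the kernel of `M` this says that `x` is a rigid motion, so the kernel has dimension `6`.
An eigenvector `x` with eigenvalue `μ ≠ 0` is orthogonal to the rigid motions, so
`‖x‖² ≤ ‖x - r‖² ≤ K n Δ⁴ μ ‖x‖²`, which is the bound on `μ`.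
-/

noncomputable section

open scoped RealInnerProductSpace

/-! ### Quadratic forms of linear maps -/

section InnerProduct

variable {E : Type*} [NormedAddCommGroup E] [InnerProductSpace ℝ E]

/-- A bound on the quadratic form `⟪w, A w⟫` bounds its polarization. -/
theorem abs_inner_add_inner_le {A : E →L[ℝ] E} {κ : ℝ}
    (h : ∀ w, |⟪w, A w⟫| ≤ κ * ‖w‖ ^ 2) (u v : E) :
    |⟪u, A v⟫ + ⟪v, A u⟫| ≤ 2 * κ * ‖u‖ * ‖v‖ := by
  rcases eq_or_ne u 0 with rfl | hu
  · simp
  rcases eq_or_ne v 0 with rfl | hv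
  · simp
  have hu' : 0 < ‖u‖ := norm_pos_iff.2 hu
  have hv' : 0 < ‖v‖ := norm_pos_iff.2 hv
  -- the parallelogram law, for vectors rescaled to the common norm `‖u‖ * ‖v‖`
  set a := ‖v‖ • u with ha
  set b := ‖u‖ • v with hb
  have h1 := abs_le.1 (h (a + b))
  have h2 := abs_le.1 (h (a - b))
  have hp := parallelogram_law_with_norm ℝ a b
  have hna : ‖a‖ = ‖u‖ * ‖v‖ := by rw [ha, norm_smul, norm_norm, mul_comm]
  have hnb : ‖b‖ = ‖u‖ * ‖v‖ := by rw [hb, norm_smul, norm_norm]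
  rw [hna, hnb] at hp
  have hpol : 2 * (‖u‖ * ‖v‖) * (⟪u, A v⟫ + ⟪v, A u⟫)
      = ⟪a + b, A (a + b)⟫ - ⟪a - b, A (a - b)⟫ := by
    simp only [map_add, map_sub, inner_add_left, inner_add_right, inner_sub_left, inner_sub_right]
    simp only [ha, hb, map_smul, real_inner_smul_left, real_inner_smul_right]
    ring
  have hpos : 0 < ‖u‖ * ‖v‖ := mul_pos hu' hv'
  have hκ : κ * (‖a + b‖ ^ 2 + ‖a - b‖ ^ 2) = 2 * (‖u‖ * ‖v‖) * (2 * κ * ‖u‖ * ‖v‖) := by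
    linear_combination κ * hp
  rw [abs_le]
  constructor
  · refine le_of_mul_le_mul_left (a := 2 * (‖u‖ * ‖v‖)) ?_ (by positivity)
    rw [hpol]; linarith
  · refine le_of_mul_le_mul_left (a := 2 * (‖u‖ * ‖v‖)) ?_ (by positivity)
    rw [hpol]; linarith

/-- The symmetric part of a linear map is bounded by its quadratic form. -/
theorem norm_apply_add_adjoint_le [CompleteSpace E] {A : E →L[ℝ] E} {κ : ℝ}
    (h : ∀ w, |⟪w, A w⟫| ≤ κ * ‖w‖ ^ 2) (w : E) :
    ‖A w + A.adjoint w‖ ≤ 2 * κ * ‖w‖ := by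
  set z := A w + A.adjoint w with hz
  rcases eq_or_ne z 0 with h0 | h0
  · have := (abs_nonneg _).trans (h w)
    rcases eq_or_ne w 0 with rfl | hw
    · simp [h0]
    · have hw' : 0 < ‖w‖ := norm_pos_iff.2 hw
      have : 0 ≤ κ := nonneg_of_mul_nonneg_left this (by positivity)
      rw [h0, norm_zero]; positivity
  have h0' : 0 < ‖z‖ := norm_pos_iff.2 h0
  have h1 := abs_le.1 (abs_inner_add_inner_le h z w)
  have h2 : ⟪z, A w⟫ + ⟪w, A z⟫ = ‖z‖ ^ 2 := by
    rw [← A.adjoint_inner_left z w, real_inner_comm z (A.adjoint w),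
      ← inner_add_right, ← hz, real_inner_self_eq_norm_sq]
  rw [h2] at h1
  refine le_of_mul_le_mul_left (a := ‖z‖) ?_ h0'
  linarith [h1.2]

/-- A linear map whose kernel has codimension at most one has the form `w ↦ ⟪ν, w⟫ • a`, so that
its symmetric part, hence its quadratic form, controls the whole map. -/
theorem norm_apply_le_of_finrank_ker [FiniteDimensional ℝ E] {D : E →L[ℝ] E} {κ : ℝ}
    (h : ∀ w, |⟪w, D w⟫| ≤ κ * ‖w‖ ^ 2)
    (hD : Module.finrank ℝ E ≤ Module.finrank ℝ (LinearMap.ker (D : E →ₗ[ℝ] E)) + 1) (w : E) :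
    ‖D w‖ ≤ 2 * κ * ‖w‖ := by
  set K := LinearMap.ker (D : E →ₗ[ℝ] E) with hK
  have hr := K.finrank_add_finrank_orthogonal
  have hle : Module.finrank ℝ Kᗮ ≤ 1 := by omega
  obtain ⟨⟨ν, hν⟩, hspan⟩ := finrank_le_one_iff.1 hle
  -- it suffices to treat the component of `w` orthogonal to the kernel
  obtain ⟨y, hy, z, hz, rfl⟩ := K.exists_add_mem_mem_orthogonal w
  have hDy : D y = 0 := hy
  have hyz : ⟪y, z⟫ = 0 := hz y hy
  have hzle : ‖z‖ ≤ ‖y + z‖ := by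
    have := norm_add_sq_eq_norm_sq_add_norm_sq_real hyz
    nlinarith [norm_nonneg z, norm_nonneg (y + z), mul_self_nonneg ‖y‖]
  rcases eq_or_ne z 0 with rfl | hz0
  · have := (abs_nonneg _).trans (h y)
    rcases eq_or_ne y 0 with rfl | hw
    · simp
    · have hw' : 0 < ‖y‖ := norm_pos_iff.2 hw
      have : 0 ≤ κ := nonneg_of_mul_nonneg_left this (by positivity)
      simp only [add_zero, hDy, norm_zero]; positivity
  have hz' : 0 < ‖z‖ := norm_pos_iff.2 hz0
  have hκ : 0 ≤ κ := nonneg_of_mul_nonneg_left ((abs_nonneg _).trans (h z)) (by positivity)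
  refine le_trans ?_ (mul_le_mul_of_nonneg_left hzle (by positivity))
  rw [map_add, hDy, zero_add]
  rcases eq_or_ne (D z) 0 with ha0 | ha0
  · rw [ha0, norm_zero]; positivity
  -- as `D = ⟪ν, ·⟫ • a` and `z` is parallel to `ν`, the cross term `⟪z, D (D z)⟫` is nonnegative
  have hform : ‖z‖ ^ 2 * ⟪z, D (D z)⟫ = ⟪z, D z⟫ ^ 2 := by
    obtain ⟨y', hy', z', hz'', hsum⟩ := K.exists_add_mem_mem_orthogonal (D z)
    obtain ⟨s, hs⟩ := hspan ⟨z, hz⟩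
    obtain ⟨s', hs'⟩ := hspan ⟨z', hz''⟩
    have hs1 : s • ν = z := congrArg Subtype.val hs
    have hs2 : s' • ν = z' := congrArg Subtype.val hs'
    have hDy' : D y' = 0 := hy'
    have hy'z : ⟪z, y'⟫ = 0 := by rw [real_inner_comm]; exact hz y' hy'
    have e1 : D (D z) = s' • D ν := by
      conv_lhs => rw [hsum]
      rw [map_add, hDy', zero_add, ← hs2, map_smul]
    have e2 : ⟪z, D z⟫ = s * s' * ‖ν‖ ^ 2 := by
      conv_lhs => rw [hsum]
      rw [inner_add_right, hy'z, zero_add, ← hs1, ← hs2, real_inner_smul_left,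
        real_inner_smul_right, real_inner_self_eq_norm_sq]
      ring
    have e3 : D z = s • D ν := by rw [← hs1, map_smul]
    have e4 : ‖z‖ ^ 2 = s ^ 2 * ‖ν‖ ^ 2 := by
      rw [← hs1, norm_smul, mul_pow, Real.norm_eq_abs, sq_abs]
    have e5 : ⟪z, D z⟫ = s * ⟪z, D ν⟫ := by rw [e3, real_inner_smul_right]
    rw [e1, real_inner_smul_right, e4, sq, e5]
    have : s * ⟪z, D ν⟫ = s * s' * ‖ν‖ ^ 2 := by rw [← e5, e2]
    linear_combination (-(s * ⟪z, D ν⟫)) * this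
  have hnn : 0 ≤ ⟪z, D (D z)⟫ := by
    refine nonneg_of_mul_nonneg_right (a := ‖z‖ ^ 2) ?_ (by positivity)
    rw [hform]; positivity
  have h1 := (abs_le.1 (abs_inner_add_inner_le h (D z) z)).2
  rw [real_inner_self_eq_norm_sq] at h1
  have ha' : 0 < ‖D z‖ := norm_pos_iff.2 ha0
  refine le_of_mul_le_mul_left (a := ‖D z‖) ?_ ha'
  linarith

/-- For coefficients of sum zero, the quadratic form at `∑ cᵢ pᵢ` is a combination of its values at
the differences `pᵢ - pⱼ`. -/
theorem sum_mul_inner_sub_apply_sub {ι : Type*} (s : Finset ι) (c : ι → ℝ) (p : ι → E)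
    (A : E →L[ℝ] E) (hc : ∑ i ∈ s, c i = 0) :
    ∑ i ∈ s, ∑ j ∈ s, c i * c j * ⟪p i - p j, A (p i - p j)⟫
      = -2 * ⟪∑ i ∈ s, c i • p i, A (∑ i ∈ s, c i • p i)⟫ := by
  have h1 : ∀ i j, c i * c j * ⟪p i - p j, A (p i - p j)⟫
      = c i * ⟪p i, A (p i)⟫ * c j + c i * (c j * ⟪p j, A (p j)⟫)
        - (⟪c i • p i, A (c j • p j)⟫ + ⟪c j • p j, A (c i • p i)⟫) := by
    intro i j
    simp only [map_sub, inner_sub_left, inner_sub_right, map_smul, real_inner_smul_left,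
      real_inner_smul_right]
    ring
  have h2 : ⟪∑ i ∈ s, c i • p i, A (∑ i ∈ s, c i • p i)⟫
      = ∑ i ∈ s, ∑ j ∈ s, ⟪c i • p i, A (c j • p j)⟫ := by
    rw [sum_inner]
    exact Finset.sum_congr rfl fun i _ => by rw [map_sum, inner_sum]
  have h3 : ∑ i ∈ s, ∑ j ∈ s, ⟪c j • p j, A (c i • p i)⟫
      = ∑ i ∈ s, ∑ j ∈ s, ⟪c i • p i, A (c j • p j)⟫ := Finset.sum_comm
  simp only [h1, Finset.sum_sub_distrib, Finset.sum_add_distrib, ← Finset.mul_sum]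
  rw [h3, ← h2, ← Finset.sum_mul, hc]
  simp only [mul_zero]
  rw [← Finset.sum_mul, hc]
  ring

theorem exists_sum_smul_of_mem_convexHull_image {ι : Type*} {s : Finset ι} {p : ι → E} {x : E}
    (hx : x ∈ convexHull ℝ (p '' (s : Set ι))) :
    ∃ a : ι → ℝ, (∀ i ∈ s, 0 ≤ a i) ∧ ∑ i ∈ s, a i = 1 ∧ ∑ i ∈ s, a i • p i = x := by
  classical
  have hsub : convexHull ℝ (p '' (s : Set ι)) ⊆
      {x | ∃ a : ι → ℝ, (∀ i ∈ s, 0 ≤ a i) ∧ ∑ i ∈ s, a i = 1 ∧ ∑ i ∈ s, a i • p i = x} := by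
    refine convexHull_min ?_ ?_
    · rintro _ ⟨i, hi, rfl⟩
      have hi' : i ∈ s := hi
      exact ⟨Pi.single i 1, fun j _ => by by_cases h : j = i <;> simp [h],
        by simp [Finset.sum_pi_single', hi'], by simp [Pi.single_apply, ite_smul, hi']⟩
    · rintro _ ⟨a, ha0, ha1, rfl⟩ _ ⟨b, hb0, hb1, rfl⟩ u v hu hv huv
      refine ⟨fun i => u * a i + v * b i,
        fun i hi => add_nonneg (mul_nonneg hu (ha0 i hi)) (mul_nonneg hv (hb0 i hi)), ?_, ?_⟩
      · rw [Finset.sum_add_distrib, ← Finset.mul_sum, ← Finset.mul_sum, ha1, hb1]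
        linarith
      · simp only [add_smul, mul_smul, Finset.sum_add_distrib, Finset.smul_sum]
  exact hsub hx

/-- If the quadratic form of `A` is small on the edges of a simplex that contains a ball, it is
small everywhere: every short vector is a difference of two points of the simplex. -/
theorem abs_inner_apply_le_of_closedBall_subset {ι : Type*} (s : Finset ι) (p : ι → E)
    (A : E →L[ℝ] E) {δ ρ : ℝ} (hρ : 0 < ρ) {z : E}
    (hball : Metric.closedBall z ρ ⊆ convexHull ℝ (p '' (s : Set ι)))
    (hδ : ∀ i ∈ s, ∀ j ∈ s, |⟪p i - p j, A (p i - p j)⟫| ≤ δ) (w : E) :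
    |⟪w, A w⟫| ≤ 2 * δ / ρ ^ 2 * ‖w‖ ^ 2 := by
  have key : ∀ u : E, ‖u‖ ≤ ρ → |⟪u, A u⟫| ≤ 2 * δ := by
    intro u hu
    have h1 : z + u ∈ convexHull ℝ (p '' (s : Set ι)) := hball (by simpa using hu)
    have h2 : z ∈ convexHull ℝ (p '' (s : Set ι)) := hball (by simpa using hρ.le)
    obtain ⟨a, ha0, ha1, ha⟩ := exists_sum_smul_of_mem_convexHull_image h1
    obtain ⟨b, hb0, hb1, hb⟩ := exists_sum_smul_of_mem_convexHull_image h2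
    have hu : ∑ i ∈ s, (a i - b i) • p i = u := by
      simp only [sub_smul, Finset.sum_sub_distrib, ha, hb, add_sub_cancel_left]
    have hid := sum_mul_inner_sub_apply_sub s (fun i => a i - b i) p A
      (by rw [Finset.sum_sub_distrib, ha1, hb1, sub_self])
    rw [hu] at hid
    have habs : ∑ i ∈ s, |a i - b i| ≤ 2 := by
      calc ∑ i ∈ s, |a i - b i| ≤ ∑ i ∈ s, (a i + b i) := by
            refine Finset.sum_le_sum fun i hi => ?_
            have := ha0 i hi; have := hb0 i hi
            rw [abs_le]; constructor <;> linarith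
        _ = 2 := by rw [Finset.sum_add_distrib, ha1, hb1]; norm_num
    have hn : 0 ≤ ∑ i ∈ s, |a i - b i| := Finset.sum_nonneg fun _ _ => abs_nonneg _
    have hδ0 : 0 ≤ δ := by
      obtain ⟨i, hi⟩ : s.Nonempty := by
        by_contra hne
        rw [Finset.not_nonempty_iff_eq_empty] at hne
        simp [hne] at ha1
      exact (abs_nonneg _).trans (hδ i hi i hi)
    have hsum : |∑ i ∈ s, ∑ j ∈ s, (a i - b i) * (a j - b j) * ⟪p i - p j, A (p i - p j)⟫|
        ≤ (∑ i ∈ s, |a i - b i|) * (∑ i ∈ s, |a i - b i|) * δ := by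
      rw [Finset.sum_mul_sum, Finset.sum_mul]
      refine (Finset.abs_sum_le_sum_abs _ _).trans (Finset.sum_le_sum fun i hi => ?_)
      rw [Finset.sum_mul]
      refine (Finset.abs_sum_le_sum_abs _ _).trans (Finset.sum_le_sum fun j hj => ?_)
      rw [abs_mul, abs_mul]
      exact mul_le_mul_of_nonneg_left (hδ i hi j hj) (by positivity)
    rw [hid, abs_mul, abs_neg, abs_two] at hsum
    have : (∑ i ∈ s, |a i - b i|) * (∑ i ∈ s, |a i - b i|) ≤ 2 * 2 :=
      mul_le_mul habs habs hn (by norm_num)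
    nlinarith
  rcases eq_or_ne w 0 with rfl | hw
  · simp
  have hw' : 0 < ‖w‖ := norm_pos_iff.2 hw
  have := key ((ρ / ‖w‖) • w) (by
    rw [norm_smul, Real.norm_eq_abs, abs_of_pos (by positivity)]; field_simp; rfl)
  rw [map_smul, real_inner_smul_left, real_inner_smul_right, ← mul_assoc, abs_mul,
    abs_of_pos (by positivity : 0 < ρ / ‖w‖ * (ρ / ‖w‖))] at this
  rw [div_mul_eq_mul_div, le_div_iff₀ (by positivity)]
  calc |⟪w, A w⟫| * ρ ^ 2 = ρ / ‖w‖ * (ρ / ‖w‖) * |⟪w, A w⟫| * ‖w‖ ^ 2 := by field_simp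
    _ ≤ 2 * δ * ‖w‖ ^ 2 := by gcongr

end InnerProduct

/-! ### Inscribed balls and the number of tetrahedra at a vertex -/

namespace TetMesh

variable {V : Type*} (M : TetMesh V)

theorem interior_hull_nonempty {t : Finset V} (ht : t ∈ M.tets) :
    (interior (M.hull t)).Nonempty := by
  have h := (M.affineIndependent_tet t ht).affineSpan_eq_top_iff_card_eq_finrank_add_one.2
    (by simp [M.card_tet t ht])
  rw [hull, interior_convexHull_nonempty_iff_affineSpan_eq_top, ← h]
  congr 1
  ext x
  simp

theorem isBounded_hull (s : Finset V) : Bornology.IsBounded (M.hull s) :=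
  isBounded_convexHull.2 (s.finite_toSet.image _).isBounded

/-- Three points do not span `ℝ³` affinely. -/
theorem interior_hull_eq_empty {s : Finset V} (hs : s.card ≤ 3) :
    interior (M.hull s) = ∅ := by
  classical
  by_contra h
  rw [← ne_eq, ← Set.nonempty_iff_ne_empty, hull,
    interior_convexHull_nonempty_iff_affineSpan_eq_top] at h
  have hv : vectorSpan ℝ (M.pos '' (s : Set V)) = ⊤ := by
    rw [← direction_affineSpan, h, AffineSubspace.direction_top]
  have hne : s.Nonempty := by
    by_contra hne
    rw [Finset.not_nonempty_iff_eq_empty] at hne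
    subst hne
    simp at h
  have := finrank_vectorSpan_image_finset_le ℝ M.pos s (n := s.card - 1)
    (by have := hne.card_pos; omega)
  rw [Finset.coe_image, hv, finrank_top, finrank_euclideanSpace_fin] at this
  omega

/-- A tetrahedron with an edge of length at least `ℓ` and aspect ratio at most `α` contains a ball
whose radius depends on `ℓ` and `α` only. -/
theorem exists_closedBall_subset_hull {t : Finset V} (ht : t ∈ M.tets) {α ℓ : ℝ} (hα : 0 < α)
    (hℓ : 0 < ℓ) (hasp : aspectRatio (M.hull t) ≤ α) {i j : V} (hi : i ∈ t) (hj : j ∈ t)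
    (hij : ℓ ≤ dist (M.pos i) (M.pos j)) :
    ∃ z, Metric.closedBall z (ℓ / (4 * α)) ⊆ M.hull t := by
  have hbdd := M.isBounded_hull t
  have hout : ℓ / 2 ≤ outerRadius (M.hull t) := by
    obtain ⟨r, hr0, hr⟩ := hbdd.subset_closedBall_lt 0 0
    refine le_csInf ⟨r, hr0.le, 0, hr⟩ ?_
    rintro r ⟨hr0, c, hc⟩
    have h1 := hc (subset_convexHull ℝ _ (Set.mem_image_of_mem M.pos (Finset.mem_coe.2 hi)))
    have h2 := hc (subset_convexHull ℝ _ (Set.mem_image_of_mem M.pos (Finset.mem_coe.2 hj)))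
    rw [Metric.mem_closedBall] at h1 h2
    linarith [dist_triangle_right (M.pos i) (M.pos j) c]
  -- the radii of the balls inside the tetrahedron are bounded and one of them is positive, so that
  -- their supremum has no junk value
  have hinbdd : BddAbove {r : ℝ | 0 ≤ r ∧ ∃ c : Point3, Metric.closedBall c r ⊆ M.hull t} := by
    refine ⟨Metric.diam (M.hull t), ?_⟩
    rintro r ⟨hr0, c, hc⟩
    have := Metric.diam_mono hc hbdd
    have hd : Metric.diam (Metric.closedBall c r) = 2 * r :=
      Metric.diam_closedBall_eq c hr0
    linarith
  obtain ⟨x, hx⟩ := M.interior_hull_nonempty ht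
  obtain ⟨r, hr, hrx⟩ := Metric.nhds_basis_closedBall.mem_iff.1 (mem_interior_iff_mem_nhds.1 hx)
  have hin : 0 < innerRadius (M.hull t) := hr.trans_le (le_csSup hinbdd ⟨hr.le, x, hrx⟩)
  have hlt : ℓ / (4 * α) < innerRadius (M.hull t) := by
    rw [aspectRatio, div_le_iff₀ hin] at hasp
    rw [div_lt_iff₀ (by positivity)]
    linarith
  have hne : {r : ℝ | 0 ≤ r ∧ ∃ c : Point3, Metric.closedBall c r ⊆ M.hull t}.Nonempty :=
    ⟨r, hr.le, x, hrx⟩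
  obtain ⟨r', ⟨_, c, hc⟩, hr'⟩ := exists_lt_of_lt_csSup hne hlt
  exact ⟨c, (Metric.closedBall_subset_closedBall hr'.le).trans hc⟩

/-- Balls inside distinct tetrahedra of a simplicial complex are disjoint, because the tetrahedra
meet in a set with empty interior. -/
theorem disjoint_ball_of_isSimplicialComplex (hM : M.IsSimplicialComplex) {t t' : Finset V}
    (ht : t ∈ M.tets) (ht' : t' ∈ M.tets) (hne : t ≠ t') {z z' : Point3} {ρ : ℝ}
    (hz : Metric.closedBall z ρ ⊆ M.hull t) (hz' : Metric.closedBall z' ρ ⊆ M.hull t') :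
    Disjoint (Metric.ball z ρ) (Metric.ball z' ρ) := by
  rw [Set.disjoint_iff_inter_eq_empty, ← Set.subset_empty_iff]
  have hsub : Metric.ball z ρ ∩ Metric.ball z' ρ ⊆ M.hull t ∩ M.hull t' :=
    Set.inter_subset_inter (Metric.ball_subset_closedBall.trans hz)
      (Metric.ball_subset_closedBall.trans hz')
  rcases hM t ht t' ht' with h | ⟨s, -, hs, hs', h⟩
  · rwa [h] at hsub
  have hlt : s ⊂ t := by
    refine hs.ssubset_of_ne ?_
    rintro rfl
    exact hne (Finset.eq_of_subset_of_card_le hs' (by rw [M.card_tet _ ht, M.card_tet _ ht']))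
  have hcard := Finset.card_lt_card hlt
  rw [M.card_tet t ht] at hcard
  rw [h] at hsub
  rw [← M.interior_hull_eq_empty (Nat.le_of_lt_succ hcard)]
  exact interior_maximal hsub (Metric.isOpen_ball.inter Metric.isOpen_ball)

open MeasureTheory in
/-- Volume bound for the number of tetrahedra inside a ball. -/
theorem card_mul_pow_le (hM : M.IsSimplicialComplex) {ρ R : ℝ} (hρ : 0 < ρ) (hR : 0 < R)
    (S : Finset (Finset V)) (hS : S ⊆ M.tets)
    (hball : ∀ t ∈ S, ∃ z, Metric.closedBall z ρ ⊆ M.hull t) {x : Point3}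
    (hx : ∀ t ∈ S, M.hull t ⊆ Metric.closedBall x R) :
    (S.card : ℝ) * ρ ^ 3 ≤ R ^ 3 := by
  classical
  choose! z hz using hball
  have hdisj : (S : Set (Finset V)).PairwiseDisjoint fun t => Metric.ball (z t) ρ :=
    fun t ht t' ht' hne => M.disjoint_ball_of_isSimplicialComplex hM (hS ht) (hS ht') hne
      (hz t ht) (hz t' ht')
  have hsub : (⋃ t ∈ S, Metric.ball (z t) ρ) ⊆ Metric.closedBall x R :=
    Set.iUnion₂_subset fun t ht => (Metric.ball_subset_closedBall.trans (hz t ht)).trans (hx t ht)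
  have hvol := measure_mono (μ := (volume : Measure Point3)) hsub
  rw [measure_biUnion_finset hdisj fun t _ => measurableSet_ball] at hvol
  simp only [Measure.addHaar_ball volume _ hρ.le, Measure.addHaar_closedBall volume _ hR.le,
    finrank_euclideanSpace_fin, Finset.sum_const, nsmul_eq_mul] at hvol
  rw [← mul_assoc, ENNReal.mul_le_mul_iff_left (Metric.measure_ball_pos volume 0 one_pos).ne'
    measure_ball_lt_top.ne, ← ENNReal.ofReal_natCast, ← ENNReal.ofReal_mul (by positivity),
    ENNReal.ofReal_le_ofReal_iff (by positivity)] at hvol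
  exact hvol

end TetMesh

/-! ### Propagation of the local affine motions -/

namespace TetMesh

variable {V : Type*} (M : TetMesh V)

/-- On the vertices of a tetrahedron every displacement field is affine. -/
theorem exists_linearPart {t : Finset V} (ht : t ∈ M.tets) (x : V → Point3) :
    ∃ A : Point3 →L[ℝ] Point3, ∀ i ∈ t, ∀ j ∈ t, x i - x j = A (M.pos i - M.pos j) := by
  classical
  obtain ⟨o, ho⟩ : t.Nonempty := Finset.card_pos.1 (by rw [M.card_tet t ht]; norm_num)
  have hli := (affineIndependent_iff_linearIndependent_vsub ℝ _
    (⟨o, ho⟩ : {x // x ∈ t})).1 (M.affineIndependent_tet t ht)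
  let b := Module.Basis.span hli
  obtain ⟨g, hg⟩ := LinearMap.exists_extend (b.constr ℝ fun i => x i.1.1 - x o)
  have hgi : ∀ i ∈ t, x i - x o = g (M.pos i - M.pos o) := by
    intro i hi
    by_cases hio : i = o
    · simp [hio]
    have h1 := LinearMap.congr_fun hg (b ⟨⟨i, hi⟩, fun h => hio (congrArg Subtype.val h)⟩)
    rw [b.constr_basis, LinearMap.comp_apply] at h1
    rw [← h1]
    congr 1
    simp [b, Module.Basis.span_apply]
  refine ⟨LinearMap.toContinuousLinearMap g, fun i hi j hj => ?_⟩
  rw [LinearMap.coe_toContinuousLinearMap', ← sub_sub_sub_cancel_right (x i) (x j) (x o),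
    hgi i hi, hgi j hj, ← map_sub, sub_sub_sub_cancel_right]

/-- The linear parts of a displacement field on two tetrahedra with a common triangle agree on the
plane of the triangle, so that their difference is controlled by quadratic forms. -/
theorem norm_sub_apply_le_of_adj {t t' : {t // t ∈ M.tets}} (hadj : M.rigidityGraph.Adj t t')
    {x : V → Point3} {A A' : Point3 →L[ℝ] Point3} {κ : ℝ}
    (hA : ∀ i ∈ t.1, ∀ j ∈ t.1, x i - x j = A (M.pos i - M.pos j))
    (hA' : ∀ i ∈ t'.1, ∀ j ∈ t'.1, x i - x j = A' (M.pos i - M.pos j))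
    (hκ : ∀ w, |⟪w, A w⟫| ≤ κ * ‖w‖ ^ 2) (hκ' : ∀ w, |⟪w, A' w⟫| ≤ κ * ‖w‖ ^ 2) (w : Point3) :
    ‖A w - A' w‖ ≤ 4 * κ * ‖w‖ := by
  obtain ⟨-, f, hf, hft, hft'⟩ := hadj
  have hquad : ∀ w, |⟪w, (A - A') w⟫| ≤ 2 * κ * ‖w‖ ^ 2 := by
    intro w
    rw [_root_.sub_apply, inner_sub_right]
    have h1 := abs_le.1 (hκ w)
    have h2 := abs_le.1 (hκ' w)
    rw [abs_le]; constructor <;> linarith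
  have hind : AffineIndependent ℝ fun i : {x // x ∈ f} => M.pos i.1 :=
    (M.affineIndependent_tet t.1 t.2).comp_embedding
      ⟨fun i : {x // x ∈ f} => (⟨i.1, hft i.2⟩ : {x // x ∈ t.1}),
        fun i j h => Subtype.ext (congrArg (fun z : {x // x ∈ t.1} => z.1) h)⟩
  have hle : vectorSpan ℝ (Set.range fun i : {x // x ∈ f} => M.pos i.1)
      ≤ LinearMap.ker ((A - A' : Point3 →L[ℝ] Point3) : Point3 →ₗ[ℝ] Point3) := by
    rw [vectorSpan_def, Submodule.span_le]
    rintro _ ⟨_, ⟨i, rfl⟩, _, ⟨j, rfl⟩, rfl⟩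
    simp only [vsub_eq_sub, SetLike.mem_coe, LinearMap.mem_ker, ContinuousLinearMap.coe_coe,
      _root_.sub_apply]
    rw [← hA _ (hft i.2) _ (hft j.2), ← hA' _ (hft' i.2) _ (hft' j.2), sub_self]
  have hfin := Submodule.finrank_mono hle
  rw [hind.finrank_vectorSpan (n := 2) (by simp [hf])] at hfin
  have := norm_apply_le_of_finrank_ker hquad
    (by rw [finrank_euclideanSpace_fin]; omega) w
  rw [_root_.sub_apply] at this
  linarith

theorem exists_mem_tets_of_stifflyConnected (hM : M.StifflyConnected) (v : V) :
    ∃ t : {t // t ∈ M.tets}, v ∈ t.1 := by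
  obtain ⟨t⟩ := (hM.2 v).nonempty
  exact ⟨t.1, t.2⟩

theorem edgeGraph_connected (hM : M.StifflyConnected) : M.edgeGraph.Connected := by
  have hin : ∀ t : {t // t ∈ M.tets}, ∀ i ∈ t.1, ∀ j ∈ t.1, M.edgeGraph.Reachable i j := by
    intro t i hi j hj
    by_cases hij : i = j
    · rw [hij]
    · exact SimpleGraph.Adj.reachable ⟨hij, t.1, t.2, hi, hj⟩
  have hwalk : ∀ t t' : {t // t ∈ M.tets}, M.rigidityGraph.Walk t t' →
      ∀ i ∈ t.1, ∀ j ∈ t'.1, M.edgeGraph.Reachable i j := by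
    intro t t' p
    induction p with
    | nil => exact hin _
    | cons h p ih =>
      intro i hi j hj
      obtain ⟨-, f, hf, hft, hft'⟩ := h
      obtain ⟨k, hk⟩ : f.Nonempty := Finset.card_pos.1 (by omega)
      exact (hin _ i hi k (hft hk)).trans (ih k (hft' hk) j hj)
  obtain ⟨⟨t, ht⟩⟩ := hM.1.nonempty
  obtain ⟨o, ho⟩ : t.Nonempty := Finset.card_pos.1 (by rw [M.card_tet t ht]; norm_num)
  have : Nonempty V := ⟨o⟩
  refine ⟨fun u v => ?_⟩
  obtain ⟨t, ht⟩ := M.exists_mem_tets_of_stifflyConnected hM u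
  obtain ⟨t', ht'⟩ := M.exists_mem_tets_of_stifflyConnected hM v
  obtain ⟨p⟩ := hM.1.preconnected t t'
  exact hwalk t t' p u ht v ht'

/-- If the linear parts of adjacent tetrahedra differ by at most `η`, those of two tetrahedra with a
common vertex differ by at most `N * η`, where `N` bounds the number of tetrahedra at a vertex. -/
theorem norm_sub_apply_le_of_mem [DecidableEq V] (hM : M.StifflyConnected) {N : ℕ} {v : V}
    (hN : (M.tets.filter fun t => v ∈ t).card ≤ N)
    {A : {t // t ∈ M.tets} → Point3 →L[ℝ] Point3} {η : ℝ} (hη : 0 ≤ η)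
    (hA : ∀ t t', M.rigidityGraph.Adj t t' → ∀ w, ‖A t w - A t' w‖ ≤ η * ‖w‖)
    {t t' : {t // t ∈ M.tets}} (ht : v ∈ t.1) (ht' : v ∈ t'.1) (w : Point3) :
    ‖A t w - A t' w‖ ≤ N * η * ‖w‖ := by
  classical
  set S : Set {t // t ∈ M.tets} := {t | v ∈ t.1} with hS
  have hwalk : ∀ s s' : S, ∀ p : (M.rigidityGraph.induce S).Walk s s',
      ‖A s.1 w - A s'.1 w‖ ≤ p.length * (η * ‖w‖) := by
    intro s s' p
    induction p with
    | nil => simp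
    | cons h p ih =>
      refine (norm_sub_le_norm_sub_add_norm_sub _ (A _ w) _).trans
        ((add_le_add (hA _ _ h w) ih).trans_eq ?_)
      rw [SimpleGraph.Walk.length_cons]
      push_cast
      ring
  obtain ⟨p, hp⟩ := (hM.2 v).exists_isPath ⟨t, ht⟩ ⟨t', ht'⟩
  have hlen : p.length < Fintype.card S := hp.length_lt
  have hcard : Fintype.card S ≤ N := by
    refine le_trans ?_ hN
    rw [← Fintype.card_coe]
    refine Fintype.card_le_of_injective
      (fun s => ⟨s.1.1, Finset.mem_filter.2 ⟨s.1.2, s.2⟩⟩) fun s s' h => ?_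
    exact Subtype.ext (Subtype.ext (Subtype.mk.inj h))
  refine (hwalk _ _ p).trans ?_
  rw [mul_assoc]
  have : p.length ≤ N := by omega
  gcongr

/-- Along a walk of `k` edges the linear part of the displacement field changes by `O(k)`, so the
displacements deviate from a single affine motion by `O(k ^ 2)`. -/
theorem norm_displacement_sub_le_of_walk {ℓ η : ℝ} (hη : 0 ≤ η) (hℓ : 0 ≤ ℓ)
    (hlen : ∀ i j, M.edgeGraph.Adj i j → dist (M.pos i) (M.pos j) ≤ ℓ)
    {x : V → Point3} {A : {t // t ∈ M.tets} → Point3 →L[ℝ] Point3}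
    (hAx : ∀ t, ∀ i ∈ t.1, ∀ j ∈ t.1, x i - x j = A t (M.pos i - M.pos j))
    (hA : ∀ t t' : {t // t ∈ M.tets}, ∀ v ∈ t.1, v ∈ t'.1 → ∀ w, ‖A t w - A t' w‖ ≤ η * ‖w‖)
    {v o : V} (p : M.edgeGraph.Walk v o) {t₀ : {t // t ∈ M.tets}} (ht₀ : o ∈ t₀.1) :
    (∀ t : {t // t ∈ M.tets}, v ∈ t.1 → ∀ w, ‖A t w - A t₀ w‖ ≤ (p.length + 1) * η * ‖w‖) ∧
    ‖M.pos v - M.pos o‖ ≤ p.length * ℓ ∧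
    ‖x v - x o - A t₀ (M.pos v - M.pos o)‖ ≤ 2 * η * ℓ * p.length ^ 2 := by
  induction p with
  | nil =>
    refine ⟨fun t ht w => ?_, by simp, by simp⟩
    simpa using hA t t₀ _ ht ht₀ w
  | @cons v u o h p ih =>
    obtain ⟨ih1, ih2, ih3⟩ := ih ht₀
    have hd : ‖M.pos v - M.pos u‖ ≤ ℓ := by rw [← dist_eq_norm]; exact hlen v u h
    obtain ⟨t, ht, hvt, hut⟩ := h.2
    have hstep := ih1 ⟨t, ht⟩ hut
    rw [SimpleGraph.Walk.length_cons]
    push_cast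
    refine ⟨fun s hs w => ?_, ?_, ?_⟩
    · refine (norm_sub_le_norm_sub_add_norm_sub _ (A ⟨t, ht⟩ w) _).trans
        ((add_le_add (hA s ⟨t, ht⟩ v hs hvt w) (hstep w)).trans_eq ?_)
      ring
    · refine (norm_sub_le_norm_sub_add_norm_sub _ (M.pos u) _).trans
        ((add_le_add hd ih2).trans_eq ?_)
      ring
    · have hsplit : x v - x o - A t₀ (M.pos v - M.pos o)
          = (A ⟨t, ht⟩ (M.pos v - M.pos u) - A t₀ (M.pos v - M.pos u))
            + (x u - x o - A t₀ (M.pos u - M.pos o)) := by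
        rw [← hAx ⟨t, ht⟩ v hvt u hut]
        simp only [map_sub]
        abel
      rw [hsplit]
      have h1 := (hstep (M.pos v - M.pos u)).trans
        (mul_le_mul_of_nonneg_left hd (by positivity))
      refine (norm_add_le _ _).trans ((add_le_add h1 ih3).trans ?_)
      have : 0 ≤ (3 * p.length + 1) * (η * ℓ) := by positivity
      nlinarith

end TetMesh

/-! ### Infinitesimal rigid motions -/

section RigidMotion

variable {V : Type*}

open Matrix in
/-- The infinitesimal rigid motions of the points `p`: the pair `(ω, b)` of an angular and a
translational velocity moves the point `p v` with velocity `ω × p v + b`. -/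
def rigidMotion (p : V → Point3) : ((Fin 3 → ℝ) × (Fin 3 → ℝ)) →ₗ[ℝ] (V × Fin 3 → ℝ) where
  toFun q k := (q.1 ⨯₃ (p k.1).ofLp) k.2 + q.2 k.2
  map_add' q q' := by
    funext k
    simp only [Prod.fst_add, Prod.snd_add, map_add, LinearMap.add_apply, Pi.add_apply]
    ring
  map_smul' c q := by
    funext k
    simp only [Prod.smul_fst, Prod.smul_snd, map_smul, LinearMap.smul_apply, Pi.smul_apply,
      smul_eq_mul, RingHom.id_apply]
    ring

/-- The displacement of each vertex, as a vector of `ℝ³`. -/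
def displacement (x : V × Fin 3 → ℝ) (v : V) : Point3 :=
  WithLp.toLp 2 fun k => x (v, k)

open Matrix in
theorem dotProduct_self_eq_sum_norm_sq [Fintype V] (x : V × Fin 3 → ℝ) :
    x ⬝ᵥ x = ∑ v, ‖displacement x v‖ ^ 2 := by
  simp only [dotProduct, Fintype.sum_prod_type, EuclideanSpace.norm_sq_eq, displacement,
    Real.norm_eq_abs, sq_abs, ← sq]

open Matrix in
theorem rigidMotion_injective (M : TetMesh V) (hM : M.tets.Nonempty) :
    Function.Injective (rigidMotion M.pos) := by
  rw [← LinearMap.ker_eq_bot, LinearMap.ker_eq_bot']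
  rintro ⟨ω, b⟩ h
  obtain ⟨t, ht⟩ := hM
  have hv : ∀ v, ω ⨯₃ (M.pos v).ofLp + b = 0 := fun v => funext fun k => congrFun h (v, k)
  -- `w ↦ ω × w` vanishes on the differences of the points of a tetrahedron, which span `ℝ³`
  let L : Point3 →ₗ[ℝ] (Fin 3 → ℝ) :=
    (crossProduct ω).comp (WithLp.linearEquiv 2 ℝ (Fin 3 → ℝ)).toLinearMap
  have hspan : vectorSpan ℝ (Set.range fun i : {x // x ∈ t} => M.pos i.1) ≤ LinearMap.ker L := by
    rw [vectorSpan_def, Submodule.span_le]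
    rintro _ ⟨_, ⟨i, rfl⟩, _, ⟨j, rfl⟩, rfl⟩
    have h1 := hv i.1
    have h2 := hv j.1
    change ω ⨯₃ ((M.pos i.1).ofLp - (M.pos j.1).ofLp) = 0
    rw [map_sub, ← add_sub_add_right_eq_sub _ _ b, h1, h2, sub_zero]
  rw [(M.affineIndependent_tet t ht).vectorSpan_eq_top_of_card_eq_finrank_add_one
    (by simp [M.card_tet t ht]), top_le_iff, LinearMap.ker_eq_top] at hspan
  have hL : ∀ w : Fin 3 → ℝ, ω ⨯₃ w = 0 := fun w =>
    LinearMap.congr_fun hspan (WithLp.toLp 2 w)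
  have h0 := hL ![1, 0, 0]
  have h1 := hL ![0, 1, 0]
  have hω : ω = 0 := by
    rw [cross_apply] at h0 h1
    have e1 := congrFun h0 1
    have e2 := congrFun h0 2
    have e3 := congrFun h1 2
    simp at e1 e2 e3
    funext k
    fin_cases k
    · exact e3
    · exact e2
    · exact e1
  refine Prod.ext hω ?_
  have := hv (Classical.choose (Finset.card_pos.1 (by rw [M.card_tet t ht]; norm_num : 0 < t.card)))
  simpa [hω] using this

/-- A rigid motion does not change the length of any edge to first order. -/
theorem inner_displacement_rigidMotion (p : V → Point3) (q : (Fin 3 → ℝ) × (Fin 3 → ℝ)) (i j : V) :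
    ⟪p i - p j, displacement (rigidMotion p q) i - displacement (rigidMotion p q) j⟫ = 0 := by
  simp only [PiLp.inner_apply, Fin.sum_univ_three, displacement, rigidMotion, LinearMap.coe_mk,
    AddHom.coe_mk, cross_apply, PiLp.sub_apply, RCLike.inner_apply, conj_trivial]
  simp only [Matrix.cons_val_zero, Matrix.cons_val_one, Matrix.cons_val]
  ring

/-- Every infinitesimal motion with a skew linear part is rigid. -/
theorem exists_rigidMotion_eq (p : V → Point3) (A : Point3 →L[ℝ] Point3) (a o : Point3) :
    ∃ q, ∀ v, displacement (rigidMotion p q) v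
      = a + (1 / 2 : ℝ) • (A (p v - o) - A.adjoint (p v - o)) := by
  -- the entries of the skew part of the matrix of `A`
  set m : Fin 3 → Fin 3 → ℝ := fun k l => A (EuclideanSpace.single l 1) k with hm
  have hA : ∀ w k, A w k = ∑ l, w l * m k l := by
    intro w k
    conv_lhs => rw [← (EuclideanSpace.basisFun (Fin 3) ℝ).sum_repr w]
    simp [hm]
  have hA' : ∀ w k, A.adjoint w k = ∑ l, w l * m l k := by
    intro w k
    have h1 := A.adjoint_inner_left (EuclideanSpace.single k (1 : ℝ)) w
    rw [EuclideanSpace.inner_single_right, PiLp.inner_apply] at h1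
    simp only [conj_trivial, one_mul] at h1
    rw [h1]
    exact Finset.sum_congr rfl fun l _ => by simp [hm, mul_comm]
  set ω : Fin 3 → ℝ := ![(m 2 1 - m 1 2) / 2, (m 0 2 - m 2 0) / 2, (m 1 0 - m 0 1) / 2] with hω
  refine ⟨(ω, a.ofLp - crossProduct ω o.ofLp), fun v => ?_⟩
  ext k
  simp only [displacement, rigidMotion, LinearMap.coe_mk, AddHom.coe_mk, PiLp.add_apply,
    PiLp.smul_apply, PiLp.sub_apply, hA, hA', Fin.sum_univ_three, cross_apply, Pi.sub_apply,
    smul_eq_mul]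
  fin_cases k <;> simp [hω] <;> ring

end RigidMotion

namespace TetMesh

variable {V : Type*} [Fintype V] [DecidableEq V] (M : TetMesh V)

/-- A displacement field that changes every edge by little is close to a rigid motion. -/
theorem exists_norm_displacement_sub_le (hM : M.StifflyConnected) {N : ℕ} {ρ ℓ δ : ℝ} (hρ : 0 < ρ)
    (hℓ : 0 ≤ ℓ) (hδ : 0 ≤ δ) (hball : ∀ t ∈ M.tets, ∃ z, Metric.closedBall z ρ ⊆ M.hull t)
    (hN : ∀ v, (M.tets.filter fun t => v ∈ t).card ≤ N)
    (hlen : ∀ i j, M.edgeGraph.Adj i j → dist (M.pos i) (M.pos j) ≤ ℓ)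
    (x : V × Fin 3 → ℝ)
    (hx : ∀ i j, M.edgeGraph.Adj i j →
      |⟪M.pos i - M.pos j, displacement x i - displacement x j⟫| ≤ δ) :
    ∃ q, ∀ v, ‖displacement x v - displacement (rigidMotion M.pos q) v‖
      ≤ (8 * N + 1) * (2 * δ / ρ ^ 2) * ℓ * (M.edgeGraph.diam : ℝ) ^ 2 := by
  set κ := 2 * δ / ρ ^ 2 with hκdef
  have hκ0 : 0 ≤ κ := by positivity
  have hex := fun t : {t // t ∈ M.tets} => M.exists_linearPart t.2 (displacement x)
  choose A hA using hex
  have hκ : ∀ t w, |⟪w, A t w⟫| ≤ κ * ‖w‖ ^ 2 := by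
    intro t w
    obtain ⟨z, hz⟩ := hball t.1 t.2
    refine abs_inner_apply_le_of_closedBall_subset t.1 M.pos (A t) hρ hz (fun i hi j hj => ?_) w
    rw [← hA t i hi j hj]
    by_cases hij : i = j
    · simpa [hij] using hδ
    · exact hx i j ⟨hij, t.1, t.2, hi, hj⟩
  have hstep : ∀ t t' : {t // t ∈ M.tets}, ∀ v ∈ t.1, v ∈ t'.1 → ∀ w,
      ‖A t w - A t' w‖ ≤ N * (4 * κ) * ‖w‖ := fun t t' v ht ht' w =>
    M.norm_sub_apply_le_of_mem hM (hN v) (by positivity)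
      (fun s s' h w => M.norm_sub_apply_le_of_adj h (hA s) (hA s') (hκ s) (hκ s') w) ht ht' w
  have hconn := M.edgeGraph_connected hM
  have hne := hconn.nonempty
  obtain ⟨o⟩ := hconn.nonempty
  obtain ⟨t₀, ht₀⟩ := M.exists_mem_tets_of_stifflyConnected hM o
  obtain ⟨q, hq⟩ := exists_rigidMotion_eq M.pos (A t₀) (displacement x o) (M.pos o)
  refine ⟨q, fun v => ?_⟩
  obtain ⟨p, hp⟩ := hconn.exists_walk_length_eq_dist v o
  have hpd : p.length ≤ M.edgeGraph.diam :=
    hp.trans_le (SimpleGraph.dist_le_diam (SimpleGraph.connected_iff_ediam_ne_top.1 hconn))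
  obtain ⟨-, hdist, hdisp⟩ :=
    M.norm_displacement_sub_le_of_walk (by positivity) hℓ hlen hA hstep p ht₀
  have hsym := norm_apply_add_adjoint_le (hκ t₀) (M.pos v - M.pos o)
  set w := M.pos v - M.pos o
  have hsplit : displacement x v - displacement (rigidMotion M.pos q) v
      = (displacement x v - displacement x o - A t₀ w)
        + (1 / 2 : ℝ) • (A t₀ w + (A t₀).adjoint w) := by
    rw [hq v]
    module
  rw [hsplit]
  have hk : (p.length : ℝ) ≤ (M.edgeGraph.diam : ℝ) ^ 2 := by
    exact_mod_cast hpd.trans (Nat.le_self_pow two_ne_zero _)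
  have hk2 : (p.length : ℝ) ^ 2 ≤ (M.edgeGraph.diam : ℝ) ^ 2 := by gcongr
  calc _ ≤ 2 * (N * (4 * κ)) * ℓ * p.length ^ 2 + 1 / 2 * (2 * κ * (p.length * ℓ)) := by
        refine (norm_add_le _ _).trans (add_le_add hdisp ?_)
        rw [norm_smul, Real.norm_of_nonneg (by norm_num)]
        exact mul_le_mul_of_nonneg_left
          (hsym.trans (mul_le_mul_of_nonneg_left hdist (by positivity))) (by norm_num)
    _ = 8 * N * κ * ℓ * p.length ^ 2 + κ * ℓ * p.length := by ring
    _ ≤ 8 * N * κ * ℓ * (M.edgeGraph.diam : ℝ) ^ 2 + κ * ℓ * (M.edgeGraph.diam : ℝ) ^ 2 := by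
        gcongr
    _ = _ := by ring

end TetMesh

/-! ### The stiffness matrix -/

namespace Truss

open Matrix

variable {V : Type*} (T : Truss V)

theorem edgeLength_pos {e : Sym2 V} (he : e ∈ T.edgeGraph.edgeSet) : 0 < T.edgeLength e := by
  induction e with
  | _ i j => exact dist_pos.2 (T.pos_injective.ne he.1)

variable [Fintype V] [DecidableEq V]

theorem edgeVector_dotProduct (i j : V) (x : V × Fin 3 → ℝ) :
    T.edgeVector s(i, j) ⬝ᵥ x
      = ⟪T.pos i - T.pos j, displacement x i - displacement x j⟫ / ‖T.pos i - T.pos j‖ := by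
  simp only [dotProduct, edgeVector, Sym2.lift_mk, Fintype.sum_prod_type, sub_mul, ite_mul,
    one_mul, zero_mul, Finset.sum_sub_distrib, Fin.sum_univ_three, Finset.sum_add_distrib,
    Finset.sum_ite_eq', Finset.mem_univ, if_true, PiLp.inner_apply, displacement, PiLp.sub_apply,
    RCLike.inner_apply, conj_trivial]
  ring

open Classical in
theorem dotProduct_stiffnessMatrix_mulVec (x y : V × Fin 3 → ℝ) :
    x ⬝ᵥ T.stiffnessMatrix *ᵥ y = ∑ e ∈ T.edgeGraph.edgeFinset,
      T.stiffness e / T.edgeLength e * ((T.edgeVector e ⬝ᵥ x) * (T.edgeVector e ⬝ᵥ y)) := by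
  rw [stiffnessMatrix, sum_mulVec, dotProduct_sum]
  refine Finset.sum_congr rfl fun e _ => ?_
  rw [smul_mulVec, vecMulVec_mulVec, dotProduct_smul, dotProduct_smul]
  simp only [smul_eq_mul, MulOpposite.smul_eq_mul_unop, MulOpposite.unop_op]
  rw [dotProduct_comm x]

theorem isHermitian_stiffnessMatrix : T.stiffnessMatrix.IsHermitian := by
  rw [stiffnessMatrix]
  rw [IsHermitian, conjTranspose_sum]
  refine Finset.sum_congr rfl fun e _ => ?_
  rw [conjTranspose_smul, star_trivial, conjTranspose_eq_transpose_of_trivial,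
    transpose_vecMulVec]

theorem stiffnessMatrix_mulVec_rigidMotion (q : (Fin 3 → ℝ) × (Fin 3 → ℝ)) :
    T.stiffnessMatrix *ᵥ rigidMotion T.pos q = 0 := by
  classical
  refine dotProduct_eq_zero _ fun x => ?_
  rw [dotProduct_comm, dotProduct_stiffnessMatrix_mulVec]
  refine Finset.sum_eq_zero fun e _ => ?_
  induction e with
  | _ i j =>
    rw [edgeVector_dotProduct T i j (rigidMotion _ _), inner_displacement_rigidMotion, zero_div,
      mul_zero, mul_zero]

/-- The elastic energy of a displacement bounds its contribution on each edge. -/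
theorem sq_inner_le {ℓ γ : ℝ} (hγ : 0 < γ) (hℓ : ∀ e ∈ T.edgeGraph.edgeSet, T.edgeLength e ≤ ℓ)
    (hγe : ∀ e ∈ T.edgeGraph.edgeSet, γ ≤ T.stiffness e) (x : V × Fin 3 → ℝ) {i j : V}
    (hij : T.edgeGraph.Adj i j) :
    ⟪T.pos i - T.pos j, displacement x i - displacement x j⟫ ^ 2
      ≤ ℓ ^ 3 / γ * (x ⬝ᵥ T.stiffnessMatrix *ᵥ x) := by
  classical
  have he : s(i, j) ∈ T.edgeGraph.edgeSet := hij
  have hle := Finset.single_le_sum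
    (f := fun e => T.stiffness e / T.edgeLength e
      * ((T.edgeVector e ⬝ᵥ x) * (T.edgeVector e ⬝ᵥ x)))
    (fun e he => mul_nonneg
      (div_nonneg (T.stiffness_pos e (SimpleGraph.mem_edgeFinset.1 he)).le
        (T.edgeLength_pos (SimpleGraph.mem_edgeFinset.1 he)).le) (mul_self_nonneg _))
    (SimpleGraph.mem_edgeFinset.2 he)
  rw [← dotProduct_stiffnessMatrix_mulVec] at hle
  have hl0 := T.edgeLength_pos he
  have hl := hℓ _ he
  have hlen : T.edgeLength s(i, j) = ‖T.pos i - T.pos j‖ :=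
    dist_eq_norm (T.pos i) (T.pos j)
  simp only [edgeVector_dotProduct] at hle
  rw [hlen] at hle hl hl0
  set d := ‖T.pos i - T.pos j‖
  set I := ⟪T.pos i - T.pos j, displacement x i - displacement x j⟫
  have hs := hγe _ he
  rw [div_mul_eq_mul_div, le_div_iff₀ hγ]
  calc I ^ 2 * γ ≤ I ^ 2 * T.stiffness s(i, j) := by gcongr
    _ = d ^ 3 * (T.stiffness s(i, j) / d * (I / d * (I / d))) := by field_simp
    _ ≤ d ^ 3 * (x ⬝ᵥ T.stiffnessMatrix *ᵥ x) := by gcongr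
    _ ≤ ℓ ^ 3 * (x ⬝ᵥ T.stiffnessMatrix *ᵥ x) := by
        refine mul_le_mul_of_nonneg_right (by gcongr) ?_
        refine le_trans ?_ hle
        have := hγ.trans_le hs
        rw [← sq]
        positivity

/-- The quantitative rigidity estimate: up to a rigid motion, a displacement is bounded by its
elastic energy, with a constant that depends on the shape parameters only. -/
theorem exists_dotProduct_sub_rigidMotion_le (α ℓ₁ ℓ₂ γ₁ γ₂ : ℝ) (hℓ₁ : 0 < ℓ₁) (hγ₁ : 0 < γ₁) :
    ∃ K : ℝ, 0 < K ∧
      ∀ (V : Type*) [Fintype V] [DecidableEq V] (T : Truss V),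
        T.IsEdgeSimple α ℓ₁ ℓ₂ γ₁ γ₂ → T.StifflyConnected → ∀ x : V × Fin 3 → ℝ,
          ∃ q, (x - rigidMotion T.pos q) ⬝ᵥ (x - rigidMotion T.pos q)
            ≤ K * Fintype.card V * (T.edgeGraph.diam : ℝ) ^ 4
              * (x ⬝ᵥ T.stiffnessMatrix *ᵥ x) := by
  classical
  -- positive upper bounds for the aspect ratio and the edge lengths
  set β := max α 1 with hβ
  set ℓ := max ℓ₂ ℓ₁ with hℓ
  have hβ0 : 0 < β := lt_max_of_lt_right one_pos
  have hℓ0 : 0 < ℓ := lt_max_of_lt_right hℓ₁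
  set ρ := ℓ₁ / (4 * β) with hρ
  have hρ0 : 0 < ρ := by positivity
  set N := ⌈ℓ ^ 3 / ρ ^ 3⌉₊ with hN
  set C := (8 * N + 1) * (2 / ρ ^ 2) * ℓ with hC
  have hC0 : 0 < C := by positivity
  refine ⟨C ^ 2 * (ℓ ^ 3 / γ₁), by positivity, ?_⟩
  intro V _ _ T ⟨⟨hcomplex, hasp⟩, hedge⟩ hstiff x
  have hlen : ∀ i j, T.edgeGraph.Adj i j → dist (T.pos i) (T.pos j) ≤ ℓ := fun i j h =>
    (hedge s(i, j) h).1.2.trans (le_max_left _ _)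
  have hball : ∀ t ∈ T.tets, ∃ z, Metric.closedBall z ρ ⊆ T.hull t := by
    intro t ht
    obtain ⟨i, hi, j, hj, hij⟩ := Finset.one_lt_card.1 (by rw [T.card_tet t ht]; norm_num)
    exact T.exists_closedBall_subset_hull ht hβ0 hℓ₁ ((hasp t ht).trans (le_max_left _ _)) hi hj
      (hedge s(i, j) ⟨hij, t, ht, hi, hj⟩).1.1
  have hcard : ∀ v, (T.tets.filter fun t => v ∈ t).card ≤ N := by
    intro v
    have := T.card_mul_pow_le hcomplex hρ0 hℓ0 (T.tets.filter fun t => v ∈ t)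
      (Finset.filter_subset _ _) (fun t ht => hball t (Finset.mem_filter.1 ht).1) (x := T.pos v) ?_
    · rw [← le_div_iff₀ (by positivity)] at this
      exact_mod_cast this.trans (Nat.le_ceil _)
    · intro t ht
      obtain ⟨ht, hv⟩ := Finset.mem_filter.1 ht
      refine convexHull_min ?_ (convex_closedBall _ _)
      rintro _ ⟨i, hi, rfl⟩
      by_cases hiv : i = v
      · rw [hiv]
        exact Metric.mem_closedBall_self hℓ0.le
      · exact hlen i v ⟨hiv, t, ht, hi, hv⟩
  set Q := ℓ ^ 3 / γ₁ * (x ⬝ᵥ T.stiffnessMatrix *ᵥ x) with hQ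
  have hsq : ∀ i j, T.edgeGraph.Adj i j →
      ⟪T.pos i - T.pos j, displacement x i - displacement x j⟫ ^ 2 ≤ Q := fun i j h =>
    T.sq_inner_le hγ₁ (fun e he => (hedge e he).1.2.trans (le_max_left _ _))
      (fun e he => (hedge e he).2.1) x h
  have hQ0 : 0 ≤ Q := by
    rw [hQ, dotProduct_stiffnessMatrix_mulVec]
    refine mul_nonneg (by positivity) (Finset.sum_nonneg fun e he => ?_)
    rw [SimpleGraph.mem_edgeFinset] at he
    exact mul_nonneg (div_nonneg (T.stiffness_pos e he).le (T.edgeLength_pos he).le)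
      (mul_self_nonneg _)
  obtain ⟨q, hq⟩ := T.exists_norm_displacement_sub_le hstiff hρ0 hℓ0.le (Real.sqrt_nonneg Q) hball
    hcard hlen x fun i j h => Real.abs_le_sqrt (hsq i j h)
  refine ⟨q, ?_⟩
  have hdisp : ∀ v, ‖displacement (x - rigidMotion T.pos q) v‖ ^ 2
      ≤ C ^ 2 * (T.edgeGraph.diam : ℝ) ^ 4 * Q := by
    intro v
    have h1 : displacement (x - rigidMotion T.pos q) v
        = displacement x v - displacement (rigidMotion T.pos q) v := rfl
    rw [h1]
    refine (pow_le_pow_left₀ (norm_nonneg _) (hq v) 2).trans_eq ?_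
    have h2 : (8 * N + 1) * (2 * √Q / ρ ^ 2) * ℓ * (T.edgeGraph.diam : ℝ) ^ 2
        = C * (T.edgeGraph.diam : ℝ) ^ 2 * √Q := by rw [hC]; ring
    rw [h2, mul_pow, mul_pow, Real.sq_sqrt hQ0]
    ring
  rw [dotProduct_self_eq_sum_norm_sq]
  refine (Finset.sum_le_sum fun v _ => hdisp v).trans_eq ?_
  rw [Finset.sum_const, Finset.card_univ, nsmul_eq_mul, hQ]
  ring

/-- A displacement without elastic energy is a rigid motion, so the kernel of the stiffness matrix
has the dimension `6` of the space of rigid motions. -/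
theorem rank_stiffnessMatrix_add_six (hT : T.tets.Nonempty) {B : ℝ}
    (hB : ∀ x : V × Fin 3 → ℝ, ∃ q, (x - rigidMotion T.pos q) ⬝ᵥ (x - rigidMotion T.pos q)
      ≤ B * (x ⬝ᵥ T.stiffnessMatrix *ᵥ x)) :
    T.stiffnessMatrix.rank + 6 = 3 * Fintype.card V := by
  have hker : LinearMap.ker T.stiffnessMatrix.mulVecLin
      = LinearMap.range (rigidMotion T.pos) := by
    ext x
    rw [LinearMap.mem_ker, mulVecLin_apply]
    constructor
    · intro hx
      obtain ⟨q, hq⟩ := hB x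
      rw [hx, dotProduct_zero, mul_zero] at hq
      have h0 := dotProduct_self_eq_zero.1 (le_antisymm hq 
        (Finset.sum_nonneg fun _ _ => mul_self_nonneg _))
      exact ⟨q, (sub_eq_zero.1 h0).symm⟩
    · rintro ⟨q, rfl⟩
      exact T.stiffnessMatrix_mulVec_rigidMotion q
  have hfin := LinearMap.finrank_range_add_finrank_ker T.stiffnessMatrix.mulVecLin
  rw [hker, LinearMap.finrank_range_of_inj (rigidMotion_injective T.toTetMesh hT)] at hfin
  simp only [Module.finrank_prod, Module.finrank_fintype_fun_eq_card, Fintype.card_fin,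
    Fintype.card_prod] at hfin
  rw [Matrix.rank]
  omega

/-- An eigenvector with nonzero eigenvalue is orthogonal to the rigid motions, so subtracting a
rigid motion cannot make it shorter. -/
theorem one_le_mul_of_hasEigenvalue {B μ : ℝ} (hμ : μ ≠ 0)
    (hB : ∀ x : V × Fin 3 → ℝ, ∃ q, (x - rigidMotion T.pos q) ⬝ᵥ (x - rigidMotion T.pos q)
      ≤ B * (x ⬝ᵥ T.stiffnessMatrix *ᵥ x))
    (h : Module.End.HasEigenvalue (Matrix.toLin' T.stiffnessMatrix) μ) : 1 ≤ B * μ := by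
  obtain ⟨x, hx⟩ := h.exists_hasEigenvector
  have hxe : T.stiffnessMatrix *ᵥ x = μ • x := by
    rw [← toLin'_apply]; exact hx.apply_eq_smul
  obtain ⟨q, hq⟩ := hB x
  set r := rigidMotion T.pos q with hr
  have horth : x ⬝ᵥ r = 0 := by
    have h1 : x ⬝ᵥ T.stiffnessMatrix *ᵥ r = r ⬝ᵥ T.stiffnessMatrix *ᵥ x := by
      simp only [dotProduct_stiffnessMatrix_mulVec, mul_comm (T.edgeVector _ ⬝ᵥ x)]
    rw [hr, stiffnessMatrix_mulVec_rigidMotion, ← hr, dotProduct_zero, hxe, dotProduct_smul,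
      smul_eq_mul, dotProduct_comm] at h1
    exact (mul_eq_zero.1 h1.symm).resolve_left hμ
  have hpos : 0 < x ⬝ᵥ x := by
    refine lt_of_le_of_ne (Finset.sum_nonneg fun _ _ => mul_self_nonneg _) fun h0 => hx.2 ?_
    exact dotProduct_self_eq_zero.1 h0.symm
  rw [hxe, dotProduct_smul, smul_eq_mul, sub_dotProduct, dotProduct_sub, dotProduct_sub, horth,
    dotProduct_comm r x, horth] at hq
  have : 0 ≤ r ⬝ᵥ r := Finset.sum_nonneg fun _ _ => mul_self_nonneg _
  refine le_of_mul_le_mul_right (a := x ⬝ᵥ x) ?_ hpos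
  linarith

end Truss

end

theorem mainTheorem3 (α ℓ₁ ℓ₂ γ₁ γ₂ : ℝ) (hℓ₁ : 0 < ℓ₁) (hγ₁ : 0 < γ₁) :
    ∃ c : ℝ, 0 < c ∧
      ∀ (V : Type*) [Fintype V] [DecidableEq V] (T : Truss V),
        T.IsEdgeSimple α ℓ₁ ℓ₂ γ₁ γ₂ → T.StifflyConnected →
          T.stiffnessMatrix.rank + 6 = 3 * Fintype.card V ∧
          ∃ lam : ℝ,
            IsLeast {μ : ℝ | μ ≠ 0 ∧
              Module.End.HasEigenvalue (Matrix.toLin' T.stiffnessMatrix) μ} lam ∧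
            c * (Fintype.card V : ℝ)⁻¹ * ((T.edgeGraph.diam : ℝ) ^ 4)⁻¹ ≤ lam := by
  obtain ⟨K, hK, hmain⟩ :=
    Truss.exists_dotProduct_sub_rigidMotion_le α ℓ₁ ℓ₂ γ₁ γ₂ hℓ₁ hγ₁
  refine ⟨K⁻¹, inv_pos.2 hK, fun V _ _ T hT hstiff => ?_⟩
  have hB := hmain V T hT hstiff
  set B := K * Fintype.card V * (T.edgeGraph.diam : ℝ) ^ 4 with hBdef
  obtain ⟨⟨t, ht⟩⟩ := hstiff.1.nonempty
  have hrank := T.rank_stiffnessMatrix_add_six ⟨t, ht⟩ hB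
  have hcard : 4 ≤ Fintype.card V := by
    rw [← T.card_tet t ht]
    exact t.card_le_univ
  refine ⟨hrank, ?_⟩
  have hne : {μ : ℝ | μ ≠ 0 ∧
      Module.End.HasEigenvalue (Matrix.toLin' T.stiffnessMatrix) μ}.Nonempty := by
    have hM : T.stiffnessMatrix ≠ 0 := by
      intro h0
      rw [h0, Matrix.rank_zero] at hrank
      omega
    obtain ⟨x, μ, hμ, hx, hxe⟩ := T.isHermitian_stiffnessMatrix.exists_eigenvector_of_ne_zero hM
    exact ⟨μ, hμ, Module.End.hasEigenvalue_of_hasEigenvector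
      (Module.End.hasEigenvector_iff.2 ⟨Module.End.mem_eigenspace_iff.2
        (by rw [Matrix.toLin'_apply, hxe]), hx⟩)⟩
  have hfin : {μ : ℝ | μ ≠ 0 ∧
      Module.End.HasEigenvalue (Matrix.toLin' T.stiffnessMatrix) μ}.Finite :=
    (Module.End.finite_hasEigenvalue _).subset fun μ h => h.2
  obtain ⟨lam, hlam, hmin⟩ := Set.exists_min_image _ id hfin hne
  refine ⟨lam, ⟨hlam, hmin⟩, ?_⟩
  have hone := T.one_le_mul_of_hasEigenvalue hlam.1 hB hlam.2
  have hB0 : 0 ≤ B := by positivity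
  have hBpos : 0 < B := by
    refine lt_of_le_of_ne hB0 fun h0 => ?_
    rw [← h0, zero_mul] at hone
    exact absurd hone (by norm_num)
  rw [← mul_inv, ← mul_inv, ← hBdef, inv_le_iff_one_le_mul₀ hBpos, mul_comm]
  exact hone
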